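/- Let $G=\mathbb{Z}_2\wr\mathbb{Z}$ be the lamplighter group: its elements are the pairs $(f,z)$ with $f\colon\mathbb{Z}\to\mathbb{Z}/2\mathbb{Z}$ finitely supported and $z\in\mathbb{Z}$, and $(f,z)(f',z')=(f+f'(\cdot-z),\,z+z')$. Let $\mu=\eta*\sigma*\eta$ be the step distribution of the switch-walk-switch (SWS) random walk, where $\eta(0,0)=\eta(f^1,0)=\tfrac12$, $f^1$ being the configuration in which only the lamp at the origin is on, and $\sigma(0,-1)=\sigma(0,1)=\tfrac12$. For a finitely supported probability measure $\nu$ put $H_\alpha(\nu)=\frac{1}{1-\alpha}\log\sum_\omega\nu(\omega)^\alpha$ for $\alpha\in(0,\infty)\setminus\{1\}$, and let $H_1(\nu)=\sum_\omega\nu(\omega)\log\frac1{\nu(\omega)}$ be the Shannon entropy (with $0\log\frac10=0$). Let $\mu^{(n)}$ denote the $n$-fold convolution of $\mu$. Then for every $\alpha\in(0,\infty)$ the limit $h_\alpha(\mu)=\lim_{n\to\infty}\frac1n H_\alpha(\mu^{(n)})$ exists and is finite, and the function $\alpha\mapsto h_\alpha(\mu)$ is real analytic on $(0,\infty)\setminus\{1\}$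 but not real analytic at $\alpha=1$. Moreover, for $\alpha\in(0,1)$, $$h_\alpha(\mu)=\varphi_\alpha\!\left(\frac{4^{1/\alpha}-4}{4^{1/\alpha}+4}\right),\qquad \varphi_\alpha(p)=p\log 2-\frac{\alpha}{2(1-\alpha)}\bigl[(1-p)\log(1-p)+(1+p)\log(1+p)\bigr],$$ and $h_\alpha(\mu)=0$ for all $\alpha\ge 1$. -/

import Mathlib

open Filter Topology

noncomputable section

/-- The lamplighter group `ℤ₂ ≀ ℤ`: an element `(f, z)` consists of a finitely supported lamp
configuration `f : ℤ → ℤ/2ℤ` and the position `z` of the lamplighter. -/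
@[ext]
structure Lamplighter where
  /-- the lamp configuration -/
  lamps : ℤ →₀ ZMod 2
  /-- the position of the lamplighter -/
  pos : ℤ
deriving DecidableEq

namespace Lamplighter

/-- Translation of a lamp configuration by `z`: `(shift z f) x = f (x - z)`. -/
def shift (z : ℤ) (f : ℤ →₀ ZMod 2) : ℤ →₀ ZMod 2 :=
  Finsupp.equivMapDomain (Equiv.addRight z) f

theorem shift_apply (z : ℤ) (f : ℤ →₀ ZMod 2) (x : ℤ) : shift z f x = f (x - z) := by
  simp [shift, Finsupp.equivMapDomain_apply, sub_eq_add_neg]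

instance : One Lamplighter := ⟨⟨0, 0⟩⟩

/-- `(f, z) (f', z') = (f + f'(· - z), z + z')`. -/
instance : Mul Lamplighter := ⟨fun g h => ⟨g.lamps + shift g.pos h.lamps, g.pos + h.pos⟩⟩

instance : Inv Lamplighter := ⟨fun g => ⟨-shift (-g.pos) g.lamps, -g.pos⟩⟩

theorem one_def : (1 : Lamplighter) = ⟨0, 0⟩ := rfl

theorem mul_def (g h : Lamplighter) :
    g * h = ⟨g.lamps + shift g.pos h.lamps, g.pos + h.pos⟩ := rfl

theorem inv_def (g : Lamplighter) : g⁻¹ = ⟨-shift (-g.pos) g.lamps, -g.pos⟩ := rfl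

instance : Group Lamplighter :=
  Group.ofLeftAxioms
    (fun a b c => by
      ext x
      · simp only [mul_def, Finsupp.add_apply, shift_apply, add_assoc, sub_sub]
      · simp only [mul_def, add_assoc])
    (fun a => by
      ext x <;> simp [mul_def, one_def, shift_apply])
    (fun a => by
      ext x <;> simp [mul_def, one_def, inv_def])

end Lamplighter

/-- The convolution `μ * ν` of two (discrete) probability measures on a group: the law of `g h`
with `g ∼ μ`, `h ∼ ν` independent. -/
def PMF.groupConv {G : Type*} [Group G] (μ ν : PMF G) : PMF G :=
  μ.bind fun g => ν.map fun h => g * h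

/-- The `n`-fold convolution `μ⁽ⁿ⁾`, the law of the `μ`-random walk at time `n`. -/
def PMF.groupConvPow {G : Type*} [Group G] (μ : PMF G) : ℕ → PMF G
  | 0 => PMF.pure 1
  | n + 1 => (PMF.groupConvPow μ n).groupConv μ

/-- The Rényi entropy `H_α(ν)`, for `α ∈ (0, ∞)`, of a finitely supported probability measure `ν`;
`H_1` is the Shannon entropy. -/
def renyiEntropy {Ω : Type*} (α : ℝ) (ν : PMF Ω) : ℝ :=
  if α = 1 then ∑' ω, (ν ω).toReal * Real.log (1 / (ν ω).toReal)
  else 1 / (1 - α) * Real.log (∑' ω, (ν ω).toReal ^ α)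

/-- The asymptotic Rényi entropy `h_α(μ) = lim_n H_α(μ⁽ⁿ⁾) / n`, for `α ∈ (0, ∞)`. -/
def asymptoticRenyiEntropy {G : Type*} [Group G] (μ : PMF G) (α : ℝ) : ℝ :=
  limUnder atTop fun n : ℕ => 1 / (n : ℝ) * renyiEntropy α (μ.groupConvPow n)

namespace Lamplighter

/-- The switch measure `η`: mass `1/2` at `(0, 0)` and `1/2` at `(f¹, 0)`, where `f¹` is the
configuration with only the lamp at the origin on. -/
def switchMeasure : PMF Lamplighter :=
  PMF.uniformOfFinset {⟨0, 0⟩, ⟨Finsupp.single 0 1, 0⟩} (Finset.insert_nonempty _ _)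

/-- The walk measure `σ`: mass `1/2` at `(0, -1)` and `1/2` at `(0, 1)`. -/
def walkMeasure : PMF Lamplighter :=
  PMF.uniformOfFinset {⟨0, -1⟩, ⟨0, 1⟩} (Finset.insert_nonempty _ _)

/-- The step distribution `μ = η * σ * η` of the switch-walk-switch random walk. -/
def swsMeasure : PMF Lamplighter :=
  (switchMeasure.groupConv walkMeasure).groupConv switchMeasure

end Lamplighter

/-- `φ_α(p) = p log 2 - α / (2 (1 - α)) [(1 - p) log (1 - p) + (1 + p) log (1 + p)]`. -/
def swsPhi (α p : ℝ) : ℝ :=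
  p * Real.log 2 -
    α / (2 * (1 - α)) * ((1 - p) * Real.log (1 - p) + (1 + p) * Real.log (1 + p))

end

/-! Since $\eta*\eta=\eta$, for $n\ge 1$ the law $\mu^{(n)}$ is explicit: run a simple random walk
on $\mathbb{Z}$ and make the lamps uniform on its range $R$, so
$\mu^{(n)}(f,z)=E[1_{S_n=z}\,1_{\mathrm{supp} f\subseteq R}\,2^{-|R|}]$ (`switchedLaw_toReal`).

For $\alpha<1$ put $s=\frac{1-\alpha}{\alpha}\log 2$. Up to polynomial factors,
$\sum\mu^{(n)}(f,z)^\alpha$ is $\cosh(s)^{n\alpha}$, whence the rate is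
$\frac{\alpha}{1-\alpha}\log\cosh s$ (`renyiRate`). Lower bound (`cosh_pow_rpow_le`): a path ending
at $z$ visits at least $|z|+1$ sites, so each mass above $z$ is at most $2^{-|z|-1}P(S_n=z)$; at a
given total this forces a large $\alpha$-sum. Subadditivity of $x^\alpha$ in $z$ then produces $E
e^{sS_n}=\cosh(s)^n$. Upper bound (`sum_mass_rpow_le`): Hölder's inequality against a weight of
polynomial total mass that dominates the uniform mass on every possible range reduces the sum to $E
e^{s|R|}$. As $R$ is an interval whose ends are visited, this is at most a polynomial times
$\cosh(s)^n$.

For $\alpha\ge1$, $0\le H_\alpha\le H_1\le H_\beta$ for every $\beta<1$, and the rate at $\beta$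
tends to $0$ as $\beta\uparrow1$. So $h_\alpha$ vanishes right of $1$ and is positive left of it,
which excludes analyticity at $1$. The formula with $\varphi_\alpha$ is the rate rewritten with
$p=\tanh s$. -/

namespace PMF

variable {G : Type*} [Group G]

/-! ### Convolution of measures on a group. -/

theorem groupConv_assoc (μ ν κ : PMF G) :
    (μ.groupConv ν).groupConv κ = μ.groupConv (ν.groupConv κ) := by
  simp only [groupConv, bind_bind, bind_map, map_bind, map_comp, Function.comp_def, mul_assoc]

theorem pure_one_groupConv (μ : PMF G) : (PMF.pure 1).groupConv μ = μ := by
  simp only [groupConv, pure_bind, one_mul]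
  exact map_id μ

theorem groupConv_apply (μ ν : PMF G) (g : G) :
    μ.groupConv ν g = ∑' h, ν h * μ (g * h⁻¹) := by
  classical
  have h1 : ∀ a, (ν.map fun h => a * h) g = ν (a⁻¹ * g) := by
    intro a
    rw [map_apply, tsum_eq_single (a⁻¹ * g)]
    · simp
    · intro b hb
      rw [if_neg]
      rintro rfl
      simp at hb
  simp only [groupConv, bind_apply, h1]
  rw [← (Equiv.divLeft g).tsum_eq]
  exact tsum_congr fun h => by simp [div_eq_mul_inv, mul_comm]

theorem groupConv_uniform_pair_apply [DecidableEq G] (μ : PMF G) {a b : G} (hab : a ≠ b)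
    (hne : ({a, b} : Finset G).Nonempty) (g : G) :
    μ.groupConv (uniformOfFinset {a, b} hne) g = 2⁻¹ * (μ (g * a⁻¹) + μ (g * b⁻¹)) := by
  rw [groupConv_apply, tsum_eq_sum (s := {a, b})]
  · rw [Finset.sum_pair hab]
    simp [uniformOfFinset_apply, Finset.card_pair hab, mul_add]
  · intro h hh
    rw [uniformOfFinset_apply, if_neg hh, zero_mul]

end PMF

namespace Lamplighter

/-! ### Effect of one switch or one walk step on a law. -/

theorem switch_ne : (⟨0, 0⟩ : Lamplighter) ≠ ⟨Finsupp.single 0 1, 0⟩ := by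
  intro h
  have := DFunLike.congr_fun (congrArg Lamplighter.lamps h) 0
  simp at this

theorem walk_ne : (⟨0, -1⟩ : Lamplighter) ≠ ⟨0, 1⟩ := by
  intro h
  have := congrArg Lamplighter.pos h
  simp at this

theorem mul_switch_inv (f : ℤ →₀ ZMod 2) (z : ℤ) :
    (⟨f, z⟩ : Lamplighter) * (⟨Finsupp.single 0 1, 0⟩ : Lamplighter)⁻¹ =
      ⟨f + Finsupp.single z 1, z⟩ := by
  ext x
  · have h : (-1 : ZMod 2) = 1 := by decide
    by_cases hx : x = z
    · simp [mul_def, inv_def, shift_apply, hx, h]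
    · have : x - z ≠ 0 := sub_ne_zero.2 hx
      simp [mul_def, inv_def, shift_apply, Ne.symm hx, Ne.symm this]
  · simp [mul_def, inv_def]

theorem mul_walk_inv (f : ℤ →₀ ZMod 2) (z d : ℤ) :
    (⟨f, z⟩ : Lamplighter) * (⟨0, d⟩ : Lamplighter)⁻¹ = ⟨f, z - d⟩ := by
  ext x
  · simp [mul_def, inv_def, shift_apply]
  · simp [mul_def, inv_def, sub_eq_add_neg]

theorem mul_zero_inv (g : Lamplighter) : g * (⟨0, 0⟩ : Lamplighter)⁻¹ = g := by
  rw [← one_def]; simp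

theorem groupConv_switchMeasure_apply (μ : PMF Lamplighter) (f : ℤ →₀ ZMod 2) (z : ℤ) :
    μ.groupConv switchMeasure ⟨f, z⟩ = 2⁻¹ * (μ ⟨f, z⟩ + μ ⟨f + Finsupp.single z 1, z⟩) := by
  rw [switchMeasure, PMF.groupConv_uniform_pair_apply _ switch_ne, mul_switch_inv, mul_zero_inv]

theorem groupConv_walkMeasure_apply (μ : PMF Lamplighter) (f : ℤ →₀ ZMod 2) (z : ℤ) :
    μ.groupConv walkMeasure ⟨f, z⟩ = 2⁻¹ * (μ ⟨f, z + 1⟩ + μ ⟨f, z - 1⟩) := by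
  rw [walkMeasure, PMF.groupConv_uniform_pair_apply _ walk_ne, mul_walk_inv, mul_walk_inv,
    sub_neg_eq_add]

theorem add_single_add_single (f : ℤ →₀ ZMod 2) (z : ℤ) :
    f + Finsupp.single z 1 + Finsupp.single z 1 = f := by
  rw [add_assoc, ← Finsupp.single_add, show (1 + 1 : ZMod 2) = 0 by decide]
  simp

/-- The probability of `f` under the uniform distribution on configurations supported in `S`. -/
noncomputable def uniformMass (S : Finset ℤ) (f : ℤ →₀ ZMod 2) : ℝ :=
  if f.support ⊆ S then (2⁻¹ : ℝ) ^ S.card else 0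

theorem support_add_single_subset_insert_iff (f : ℤ →₀ ZMod 2) (z : ℤ) (S : Finset ℤ) :
    (f + Finsupp.single z 1).support ⊆ insert z S ↔ f.support ⊆ insert z S := by
  have key : ∀ g : ℤ →₀ ZMod 2, g.support ⊆ insert z S →
      (g + Finsupp.single z 1).support ⊆ insert z S := by
    intro g hg
    refine Finsupp.support_add.trans (Finset.union_subset hg ?_)
    exact Finsupp.support_single_subset.trans (by simp)
  refine ⟨fun h => ?_, key f⟩
  have := key _ h
  rwa [add_single_add_single] at this

/-- Switching at $z$ randomises that lamp. If $z\in S$ the law is already invariant; otherwise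
exactly one of `f` and `f + single z 1` is off at $z$, and this one alone contributes. -/
theorem uniformMass_insert (S : Finset ℤ) (f : ℤ →₀ ZMod 2) (z : ℤ) :
    uniformMass (insert z S) f =
      2⁻¹ * (uniformMass S f + uniformMass S (f + Finsupp.single z 1)) := by
  by_cases hz : z ∈ S
  · have h := support_add_single_subset_insert_iff f z S
    rw [Finset.insert_eq_of_mem hz] at h ⊢
    simp only [uniformMass, h]
    ring
  · have h := support_add_single_subset_insert_iff f z S
    have hsub : ∀ g : ℤ →₀ ZMod 2, g.support ⊆ S ↔ g.support ⊆ insert z S ∧ g z = 0 := by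
      intro g
      constructor
      · intro hg
        exact ⟨hg.trans (Finset.subset_insert _ _),
          Finsupp.notMem_support_iff.1 fun hh => hz (hg hh)⟩
      · rintro ⟨hg, h0⟩ x hx
        rcases Finset.mem_insert.1 (hg hx) with rfl | h'
        · exact absurd h0 (Finsupp.mem_support_iff.1 hx)
        · exact h'
    have h2 : ∀ t : ZMod 2, t = 0 ∧ t + 1 ≠ 0 ∨ t ≠ 0 ∧ t + 1 = 0 := by decide
    have h3 : (f + Finsupp.single z (1 : ZMod 2)) z = f z + 1 := by simp
    simp only [uniformMass, hsub f, hsub (f + _), h, h3, Finset.card_insert_of_notMem hz, pow_succ]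
    by_cases hf : f.support ⊆ insert z S
    · rcases h2 (f z) with ⟨h4, h5⟩ | ⟨h4, h5⟩
      · simp [hf, h4]; ring
      · simp [hf, h4, h5]; ring
    · simp [hf]

theorem switchMeasure_toReal (f : ℤ →₀ ZMod 2) (z : ℤ) :
    (switchMeasure ⟨f, z⟩).toReal = if z = 0 then uniformMass {0} f else 0 := by
  rw [switchMeasure, PMF.uniformOfFinset_apply, Finset.card_pair switch_ne]
  by_cases hz : z = 0
  · subst hz
    have h := uniformMass_insert ∅ f 0
    have h0 : ∀ g : ℤ →₀ ZMod 2, uniformMass ∅ g = if g = 0 then 1 else 0 := by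
      intro g; simp [uniformMass]
    have h1 : f + Finsupp.single 0 1 = 0 ↔ f = Finsupp.single 0 1 := by
      constructor
      · intro hh
        have := add_single_add_single f 0
        rw [hh, zero_add] at this
        exact this.symm
      · rintro rfl
        have := add_single_add_single 0 0
        rwa [zero_add] at this
    have hne : (0 : ℤ →₀ ZMod 2) ≠ Finsupp.single 0 1 := fun hh => switch_ne (by rw [← hh])
    rw [show ({0} : Finset ℤ) = insert 0 ∅ from rfl, h, h0, h0]
    simp only [h1]
    by_cases hf : f = 0
    · subst hf; simp [hne]
    · by_cases hf' : f = Finsupp.single 0 1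
      · subst hf'; simp [hne.symm]
      · simp [hf, hf']
  · simp [hz]

theorem switchMeasure_groupConv_self :
    switchMeasure.groupConv switchMeasure = switchMeasure := by
  ext ⟨f, z⟩
  rw [← ENNReal.toReal_eq_toReal_iff' (PMF.apply_ne_top _ _) (PMF.apply_ne_top _ _),
    groupConv_switchMeasure_apply, ENNReal.toReal_mul,
    ENNReal.toReal_add (PMF.apply_ne_top _ _) (PMF.apply_ne_top _ _),
    switchMeasure_toReal, switchMeasure_toReal]
  by_cases hz : z = 0
  · subst hz
    have := uniformMass_insert {0} f 0
    simpa using this.symm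
  · simp [hz]

/-! ### The law at time n as a mixture over paths. -/

/-- The law of the walk at time `n` followed by a final switch. -/
noncomputable def switchedLaw (n : ℕ) : PMF Lamplighter :=
  (swsMeasure.groupConvPow n).groupConv switchMeasure

theorem switchedLaw_zero : switchedLaw 0 = switchMeasure := PMF.pure_one_groupConv _

theorem groupConvPow_succ_eq (n : ℕ) :
    swsMeasure.groupConvPow (n + 1) =
      ((switchedLaw n).groupConv walkMeasure).groupConv switchMeasure := by
  simp only [PMF.groupConvPow, switchedLaw]
  rw [swsMeasure]
  simp only [PMF.groupConv_assoc]

theorem switchedLaw_succ (n : ℕ) :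
    switchedLaw (n + 1) = ((switchedLaw n).groupConv walkMeasure).groupConv switchMeasure := by
  rw [switchedLaw, groupConvPow_succ_eq, PMF.groupConv_assoc _ switchMeasure,
    switchMeasure_groupConv_self]

/-- Idempotence of $\eta$ absorbs the extra switch. At time 0 this fails: the walk is still a point
mass. -/
theorem groupConvPow_eq_switchedLaw {n : ℕ} (hn : n ≠ 0) :
    swsMeasure.groupConvPow n = switchedLaw n := by
  obtain ⟨m, rfl⟩ := Nat.exists_eq_succ_of_ne_zero hn
  rw [groupConvPow_succ_eq, switchedLaw_succ]

/-- The increment `±1` encoded by a Boolean. -/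
def stepSign (b : Bool) : ℤ := if b then 1 else -1

/-- The position at time `k` of the nearest-neighbour path with increments `ω`. -/
def pathPos {n : ℕ} (ω : Fin n → Bool) (k : ℕ) : ℤ :=
  ∑ i : Fin n, if (i : ℕ) < k then stepSign (ω i) else 0

/-- The set of sites visited by a nearest-neighbour path. -/
def pathRange {n : ℕ} (ω : Fin n → Bool) : Finset ℤ :=
  (Finset.range (n + 1)).image (pathPos ω)

theorem pathPos_zero {n : ℕ} (ω : Fin n → Bool) : pathPos ω 0 = 0 := by
  simp [pathPos]

theorem pathPos_snoc_of_le {n k : ℕ} (ω : Fin n → Bool) (b : Bool) (hk : k ≤ n) :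
    pathPos (Fin.snoc ω b : Fin (n + 1) → Bool) k = pathPos ω k := by
  simp [pathPos, Fin.sum_univ_castSucc, hk]

theorem pathPos_snoc_last {n : ℕ} (ω : Fin n → Bool) (b : Bool) :
    pathPos (Fin.snoc ω b : Fin (n + 1) → Bool) (n + 1) = pathPos ω n + stepSign b := by
  simp only [pathPos, Fin.sum_univ_castSucc, Fin.snoc_castSucc, Fin.snoc_last, Fin.val_castSucc,
    Fin.val_last, Nat.lt_succ_self, if_true]
  congr 1
  refine Finset.sum_congr rfl fun i _ => ?_
  rw [if_pos i.2, if_pos (i.2.trans (Nat.lt_succ_self n))]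

theorem pathRange_snoc {n : ℕ} (ω : Fin n → Bool) (b : Bool) :
    pathRange (Fin.snoc ω b : Fin (n + 1) → Bool) =
      insert (pathPos ω n + stepSign b) (pathRange ω) := by
  rw [pathRange, Finset.range_add_one, Finset.image_insert, pathPos_snoc_last, pathRange]
  congr 1
  refine Finset.image_congr fun k hk => pathPos_snoc_of_le ω b ?_
  simpa [Nat.lt_succ_iff] using hk

theorem sum_path_succ {n : ℕ} (F : (Fin (n + 1) → Bool) → ℝ) :
    ∑ ω, F ω = ∑ ω : Fin n → Bool, (F (Fin.snoc ω true) + F (Fin.snoc ω false)) := by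
  rw [← (Fin.snocEquiv fun _ => Bool).sum_comp, Fintype.sum_prod_type, Fintype.sum_bool,
    ← Finset.sum_add_distrib]
  rfl

/-- The mass given to `(f, z)` by the randomisation of the lamps along the path `ω`. -/
noncomputable def pathMass {n : ℕ} (ω : Fin n → Bool) (f : ℤ →₀ ZMod 2) (z : ℤ) : ℝ :=
  if pathPos ω n = z then uniformMass (pathRange ω) f else 0

theorem pathMass_snoc {n : ℕ} (ω : Fin n → Bool) (b : Bool) (f : ℤ →₀ ZMod 2) (z : ℤ) :
    pathMass (Fin.snoc ω b : Fin (n + 1) → Bool) f z =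
      2⁻¹ * (pathMass ω f (z - stepSign b) +
        pathMass ω (f + Finsupp.single z 1) (z - stepSign b)) := by
  simp only [pathMass, pathPos_snoc_last, pathRange_snoc, eq_sub_iff_add_eq]
  by_cases h : pathPos ω n + stepSign b = z
  · simp only [h, if_true, uniformMass_insert]
  · simp [h]

theorem switchedLaw_toReal (n : ℕ) (f : ℤ →₀ ZMod 2) (z : ℤ) :
    (switchedLaw n ⟨f, z⟩).toReal = 2⁻¹ ^ n * ∑ ω : Fin n → Bool, pathMass ω f z := by
  induction n generalizing f z with
  | zero =>
    rw [switchedLaw_zero, switchMeasure_toReal]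
    simp [pathMass, pathRange, pathPos_zero, eq_comm]
  | succ n ih =>
    have hfin : ∀ a b c d : Lamplighter, (2⁻¹ * (2⁻¹ * (switchedLaw n a + switchedLaw n b) +
        2⁻¹ * (switchedLaw n c + switchedLaw n d))).toReal =
        2⁻¹ * (2⁻¹ * ((switchedLaw n a).toReal + (switchedLaw n b).toReal) +
          2⁻¹ * ((switchedLaw n c).toReal + (switchedLaw n d).toReal)) := by
      intro a b c d
      have ht : ∀ x, switchedLaw n x ≠ ⊤ := PMF.apply_ne_top _
      rw [ENNReal.toReal_mul, ENNReal.toReal_add, ENNReal.toReal_mul, ENNReal.toReal_mul,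
        ENNReal.toReal_add (ht _) (ht _), ENNReal.toReal_add (ht _) (ht _)]
      · simp
      · exact ENNReal.mul_ne_top (by simp) (ENNReal.add_ne_top.2 ⟨ht _, ht _⟩)
      · exact ENNReal.mul_ne_top (by simp) (ENNReal.add_ne_top.2 ⟨ht _, ht _⟩)
    rw [switchedLaw_succ, groupConv_switchMeasure_apply, groupConv_walkMeasure_apply,
      groupConv_walkMeasure_apply, hfin, ih, ih, ih, ih, sum_path_succ]
    simp only [pathMass_snoc, Finset.sum_add_distrib, ← Finset.mul_sum]
    simp only [stepSign, if_true, Bool.false_eq_true, if_false, sub_neg_eq_add]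
    ring

/-- Unit steps skip no site. The bounds on the endpoint are carried along so that the next site is
in or adjacent to the interval. -/
theorem pathRange_eq_Icc {n : ℕ} (ω : Fin n → Bool) :
    ∃ a b : ℤ, -n ≤ a ∧ a ≤ 0 ∧ 0 ≤ b ∧ b ≤ n ∧ a ≤ pathPos ω n ∧ pathPos ω n ≤ b ∧
      pathRange ω = Finset.Icc a b := by
  induction n with
  | zero => exact ⟨0, 0, by simp [pathRange, pathPos_zero]⟩
  | succ n ih =>
    rw [← Fin.snoc_init_self ω]
    obtain ⟨a, b, h1, h2, h3, h4, h5, h6, h7⟩ := ih (Fin.init ω)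
    rw [pathPos_snoc_last, pathRange_snoc, h7]
    have hs : stepSign (ω (Fin.last n)) = 1 ∨ stepSign (ω (Fin.last n)) = -1 := by
      unfold stepSign; split_ifs <;> simp
    set x := pathPos (Fin.init ω) n + stepSign (ω (Fin.last n)) with hx
    refine ⟨min a x, max b x, ?_, ?_, ?_, ?_, ?_, ?_, ?_⟩
    all_goals try (push_cast; omega)
    ext y
    simp only [Finset.mem_insert, Finset.mem_Icc]
    omega

/-! ### Finite supports and total masses. -/

/-- The configurations supported in `[-n, n]`. -/
noncomputable def configs (n : ℕ) : Finset (ℤ →₀ ZMod 2) :=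
  (Finset.Icc (-n : ℤ) n).finsupp fun _ => Finset.univ

theorem mem_configs {n : ℕ} {f : ℤ →₀ ZMod 2} :
    f ∈ configs n ↔ f.support ⊆ Finset.Icc (-n : ℤ) n := by
  simp [configs, Finset.mem_finsupp_iff]

theorem uniformMass_nonneg (S : Finset ℤ) (f : ℤ →₀ ZMod 2) : 0 ≤ uniformMass S f := by
  unfold uniformMass; positivity

theorem sum_uniformMass {n : ℕ} {S : Finset ℤ} (hS : S ⊆ Finset.Icc (-n : ℤ) n) :
    ∑ f ∈ configs n, uniformMass S f = 1 := by
  have h : (configs n).filter (fun f => f.support ⊆ S) =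
      S.finsupp fun _ => (Finset.univ : Finset (ZMod 2)) := by
    ext f
    simp only [Finset.mem_filter, mem_configs, Finset.mem_finsupp_iff, Finset.mem_univ,
      implies_true, and_true, and_iff_right_iff_imp]
    exact fun hf => hf.trans hS
  simp only [uniformMass]
  rw [← Finset.sum_filter, h, Finset.sum_const, Finset.card_finsupp]
  simp [ZMod.card]

theorem pathRange_subset {n : ℕ} (ω : Fin n → Bool) :
    pathRange ω ⊆ Finset.Icc (-n : ℤ) n := by
  obtain ⟨a, b, h1, -, -, h4, -, -, h7⟩ := pathRange_eq_Icc ω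
  rw [h7]
  exact Finset.Icc_subset_Icc h1 h4

theorem pathPos_mem_Icc {n : ℕ} (ω : Fin n → Bool) :
    pathPos ω n ∈ Finset.Icc (-n : ℤ) n :=
  pathRange_subset ω (Finset.mem_image_of_mem _ (by simp))

theorem natAbs_pathPos_lt_card {n : ℕ} (ω : Fin n → Bool) :
    (pathPos ω n).natAbs + 1 ≤ (pathRange ω).card := by
  obtain ⟨a, b, -, h2, h3, -, h5, h6, h7⟩ := pathRange_eq_Icc ω
  rw [h7, Int.card_Icc]
  omega

/-- The mass given to `(f, z)` by the law of the walk at time `n` followed by a switch. -/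
noncomputable def mass (n : ℕ) (f : ℤ →₀ ZMod 2) (z : ℤ) : ℝ :=
  2⁻¹ ^ n * ∑ ω : Fin n → Bool, pathMass ω f z

/-- The mass given to `z` by the simple random walk on `ℤ` at time `n`. -/
noncomputable def posMass (n : ℕ) (z : ℤ) : ℝ :=
  2⁻¹ ^ n * ∑ ω : Fin n → Bool, if pathPos ω n = z then 1 else 0

theorem pathMass_nonneg {n : ℕ} (ω : Fin n → Bool) (f : ℤ →₀ ZMod 2) (z : ℤ) :
    0 ≤ pathMass ω f z := by
  unfold pathMass
  split_ifs
  exacts [uniformMass_nonneg _ _, le_rfl]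

theorem mass_nonneg (n : ℕ) (f : ℤ →₀ ZMod 2) (z : ℤ) : 0 ≤ mass n f z :=
  mul_nonneg (by positivity) (Finset.sum_nonneg fun _ _ => pathMass_nonneg _ _ _)

theorem posMass_nonneg (n : ℕ) (z : ℤ) : 0 ≤ posMass n z := by
  unfold posMass; positivity

theorem sum_configs_mass (n : ℕ) (z : ℤ) : ∑ f ∈ configs n, mass n f z = posMass n z := by
  simp only [mass, posMass]
  rw [← Finset.mul_sum, Finset.sum_comm]
  congr 1
  refine Finset.sum_congr rfl fun ω _ => ?_
  by_cases h : pathPos ω n = z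
  · simp only [pathMass, h, if_true]
    exact sum_uniformMass (pathRange_subset ω)
  · simp [pathMass, h]

/-- The range contains every site between 0 and $z$. -/
theorem mass_le (n : ℕ) (f : ℤ →₀ ZMod 2) (z : ℤ) :
    mass n f z ≤ 2⁻¹ ^ (z.natAbs + 1) * posMass n z := by
  rw [mass, posMass, mul_left_comm]
  refine mul_le_mul_of_nonneg_left ?_ (by positivity)
  rw [Finset.mul_sum]
  refine Finset.sum_le_sum fun ω _ => ?_
  by_cases h : pathPos ω n = z
  · simp only [pathMass, h, if_true, mul_one]
    have h1 : (2⁻¹ : ℝ) ^ (pathRange ω).card ≤ 2⁻¹ ^ (z.natAbs + 1) :=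
      pow_le_pow_of_le_one (by norm_num) (by norm_num) (h ▸ natAbs_pathPos_lt_card ω)
    unfold uniformMass
    split_ifs
    exacts [h1, by positivity]
  · simp [pathMass, h]

theorem switchedLaw_toReal_eq_mass (n : ℕ) (f : ℤ →₀ ZMod 2) (z : ℤ) :
    (switchedLaw n ⟨f, z⟩).toReal = mass n f z := switchedLaw_toReal n f z

/-- A finite set of states carrying the law of the walk at time `n`. -/
noncomputable def states (n : ℕ) : Finset ((ℤ →₀ ZMod 2) × ℤ) :=
  configs n ×ˢ Finset.Icc (-n : ℤ) n

theorem mass_eq_zero_of_notMem {n : ℕ} {p : (ℤ →₀ ZMod 2) × ℤ} (hp : p ∉ states n) :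
    mass n p.1 p.2 = 0 := by
  rw [mass, Finset.sum_eq_zero, mul_zero]
  intro ω _
  by_contra h
  apply hp
  simp only [pathMass, uniformMass] at h
  have h1 : pathPos ω n = p.2 := by by_contra h'; simp [h'] at h
  have h2 : p.1.support ⊆ pathRange ω := by by_contra h'; simp [h'] at h
  exact Finset.mem_product.2 ⟨mem_configs.2 (h2.trans (pathRange_subset ω)),
    h1 ▸ pathPos_mem_Icc ω⟩

/-- A lamplighter element as a pair. -/
def pairEquiv : (ℤ →₀ ZMod 2) × ℤ ≃ Lamplighter where
  toFun p := ⟨p.1, p.2⟩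
  invFun g := (g.lamps, g.pos)
  left_inv _ := rfl
  right_inv _ := rfl

theorem tsum_switchedLaw (n : ℕ) {φ : ℝ → ℝ} (hφ : φ 0 = 0) :
    ∑' g, φ (switchedLaw n g).toReal = ∑ p ∈ states n, φ (mass n p.1 p.2) := by
  rw [← pairEquiv.tsum_eq, tsum_eq_sum (s := states n)]
  · exact Finset.sum_congr rfl fun p _ => by rw [← switchedLaw_toReal_eq_mass]; rfl
  · intro p hp
    have := mass_eq_zero_of_notMem hp
    rw [← switchedLaw_toReal_eq_mass] at this
    change φ (switchedLaw n ⟨p.1, p.2⟩).toReal = 0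
    rw [this, hφ]

/-! ### Exponential moments of the position and of the size of the range. -/

theorem sum_exp_mul_stepSign {n : ℕ} (c : Fin n → ℝ) :
    ∑ ω : Fin n → Bool, Real.exp (∑ k, c k * stepSign (ω k)) = ∏ k, (2 * Real.cosh (c k)) := by
  have h : ∀ k, 2 * Real.cosh (c k) = ∑ b : Bool, Real.exp (c k * stepSign b) := by
    intro k
    rw [Real.cosh_eq, Fintype.sum_bool]
    simp [stepSign]
    ring
  simp only [h, Real.exp_sum]
  rw [Finset.prod_univ_sum, Fintype.piFinset_univ]

theorem sum_exp_pathPos (n : ℕ) (s : ℝ) :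
    ∑ ω : Fin n → Bool, Real.exp (s * pathPos ω n) = (2 * Real.cosh s) ^ n := by
  have h := sum_exp_mul_stepSign (fun _ : Fin n => s)
  simp only [Finset.prod_const, Finset.card_univ, Fintype.card_fin] at h
  rw [← h]
  refine Finset.sum_congr rfl fun ω _ => ?_
  congr 1
  simp [pathPos, Finset.mul_sum]

theorem sum_exp_pathPos_sub_le (n : ℕ) (s : ℝ) (i j : ℕ) :
    ∑ ω : Fin n → Bool, Real.exp (s * (pathPos ω j - pathPos ω i)) ≤ (2 * Real.cosh s) ^ n := by
  -- A difference of two positions weights each step by 0 or ±1, so each factor is at most $2\cosh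
  -- s$.
  have h := sum_exp_mul_stepSign (fun k : Fin n => s * ((if (k : ℕ) < j then 1 else 0) -
    (if (k : ℕ) < i then 1 else 0)))
  have h2 : ∏ k : Fin n, (2 * Real.cosh (s * ((if (k : ℕ) < j then 1 else 0) -
      (if (k : ℕ) < i then 1 else 0)))) ≤ ∏ _k : Fin n, (2 * Real.cosh s) := by
    refine Finset.prod_le_prod (fun k _ => by positivity) fun k _ => ?_
    refine mul_le_mul_of_nonneg_left (Real.cosh_le_cosh.2 ?_) zero_le_two
    rw [abs_mul]
    refine mul_le_of_le_one_right (abs_nonneg s) ?_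
    split_ifs <;> simp
  rw [← h] at h2
  simp only [Finset.prod_const, Finset.card_univ, Fintype.card_fin] at h2
  refine le_trans (le_of_eq ?_) h2
  refine Finset.sum_congr rfl fun ω _ => ?_
  congr 1
  simp only [pathPos, Int.cast_sum, ← Finset.sum_sub_distrib, Finset.mul_sum]
  refine Finset.sum_congr rfl fun k _ => ?_
  split_ifs <;> simp

/-- The ends of the range are visited at some times $i,j$; summing over all pairs of times avoids
having to know which. -/
theorem exp_card_pathRange_le {n : ℕ} (ω : Fin n → Bool) (s : ℝ) :
    Real.exp (s * (pathRange ω).card) ≤ Real.exp s *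
      ∑ i ∈ Finset.range (n + 1), ∑ j ∈ Finset.range (n + 1),
        Real.exp (s * (pathPos ω j - pathPos ω i)) := by
  obtain ⟨a, b, -, h2, h3, -, -, -, h7⟩ := pathRange_eq_Icc ω
  have ha : a ∈ pathRange ω := by rw [h7, Finset.mem_Icc]; omega
  have hb : b ∈ pathRange ω := by rw [h7, Finset.mem_Icc]; omega
  obtain ⟨i, hi, hia⟩ := Finset.mem_image.1 ha
  obtain ⟨j, hj, hjb⟩ := Finset.mem_image.1 hb
  have hc : ((pathRange ω).card : ℝ) = b - a + 1 := by
    rw [h7, Int.card_Icc]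
    have : (((b + 1 - a).toNat : ℤ) : ℝ) = b - a + 1 := by
      rw [Int.toNat_of_nonneg (by omega)]; push_cast; ring
    exact_mod_cast this
  rw [hc, mul_add, mul_one, add_comm, Real.exp_add]
  refine mul_le_mul_of_nonneg_left ?_ (Real.exp_nonneg s)
  calc Real.exp (s * (b - a)) = Real.exp (s * (pathPos ω j - pathPos ω i)) := by rw [hia, hjb]
    _ ≤ ∑ j ∈ Finset.range (n + 1), Real.exp (s * (pathPos ω j - pathPos ω i)) :=
      Finset.single_le_sum (f := fun j => Real.exp (s * (pathPos ω j - pathPos ω i)))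
        (fun _ _ => Real.exp_nonneg _) hj
    _ ≤ _ := Finset.single_le_sum (f := fun i => ∑ j ∈ Finset.range (n + 1),
        Real.exp (s * (pathPos ω j - pathPos ω i)))
        (fun _ _ => Finset.sum_nonneg fun _ _ => Real.exp_nonneg _) hi

theorem sum_exp_card_pathRange_le (n : ℕ) (s : ℝ) :
    2⁻¹ ^ n * ∑ ω : Fin n → Bool, Real.exp (s * (pathRange ω).card) ≤
      Real.exp s * (n + 1) ^ 2 * Real.cosh s ^ n := by
  calc 2⁻¹ ^ n * ∑ ω : Fin n → Bool, Real.exp (s * (pathRange ω).card)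
      ≤ 2⁻¹ ^ n * ∑ ω : Fin n → Bool, Real.exp s *
        ∑ i ∈ Finset.range (n + 1), ∑ j ∈ Finset.range (n + 1),
          Real.exp (s * (pathPos ω j - pathPos ω i)) :=
        mul_le_mul_of_nonneg_left (Finset.sum_le_sum fun ω _ => exp_card_pathRange_le ω s)
          (by positivity)
    _ = 2⁻¹ ^ n * (Real.exp s * ∑ i ∈ Finset.range (n + 1), ∑ j ∈ Finset.range (n + 1),
          ∑ ω : Fin n → Bool, Real.exp (s * (pathPos ω j - pathPos ω i))) := by
        rw [← Finset.mul_sum, Finset.sum_comm]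
        congr 2
        exact Finset.sum_congr rfl fun i _ => Finset.sum_comm
    _ ≤ 2⁻¹ ^ n * (Real.exp s * ∑ i ∈ Finset.range (n + 1), ∑ j ∈ Finset.range (n + 1),
          (2 * Real.cosh s) ^ n) := by
        gcongr
        exact sum_exp_pathPos_sub_le n s _ _
    _ = Real.exp s * (n + 1) ^ 2 * Real.cosh s ^ n := by
        have : (2⁻¹ : ℝ) ^ n * 2 ^ n = 1 := by rw [← mul_pow]; norm_num
        simp only [Finset.sum_const, Finset.card_range, nsmul_eq_mul, mul_pow]
        push_cast
        linear_combination (Real.exp s * (n + 1) ^ 2 * Real.cosh s ^ n) * this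

theorem sum_posMass_mul_exp (n : ℕ) (s : ℝ) :
    ∑ z ∈ Finset.Icc (-n : ℤ) n, posMass n z * Real.exp (s * z) = Real.cosh s ^ n := by
  have h : (2⁻¹ : ℝ) ^ n * 2 ^ n = 1 := by rw [← mul_pow]; norm_num
  simp only [posMass, mul_assoc, ← Finset.mul_sum, Finset.sum_mul]
  rw [Finset.sum_comm]
  have h1 : ∀ ω : Fin n → Bool, ∑ z ∈ Finset.Icc (-n : ℤ) n,
      (if pathPos ω n = z then (1 : ℝ) else 0) * Real.exp (s * z) =
        Real.exp (s * pathPos ω n) := by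
    intro ω
    simp only [ite_mul, one_mul, zero_mul]
    rw [Finset.sum_ite_eq, if_pos (pathPos_mem_Icc ω)]
  simp only [h1, sum_exp_pathPos, mul_pow, ← mul_assoc, h, one_mul]

end Lamplighter

/-! ### Lower bound for α < 1. -/

theorem Real.rpow_sum_le_sum_rpow {ι : Type*} (s : Finset ι) {x : ι → ℝ} (hx : ∀ i, 0 ≤ x i)
    {p : ℝ} (hp : 0 < p) (hp1 : p ≤ 1) : (∑ i ∈ s, x i) ^ p ≤ ∑ i ∈ s, x i ^ p := by
  classical
  induction s using Finset.induction_on with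
  | empty => simp [Real.zero_rpow hp.ne']
  | insert a s ha ih =>
    rw [Finset.sum_insert ha, Finset.sum_insert ha]
    exact (Real.rpow_add_le_add_rpow (hx a) (Finset.sum_nonneg fun i _ => hx i) hp.le hp1).trans
      (by gcongr)

namespace Lamplighter

theorem inv_two_pow_rpow {α s : ℝ} (h : α * s = (1 - α) * Real.log 2) (k : ℕ) :
    ((2⁻¹ : ℝ) ^ k) ^ (α - 1) = Real.exp (α * (s * k)) := by
  rw [Real.rpow_def_of_pos (by positivity), Real.log_pow, Real.log_inv]
  congr 1
  linear_combination (-(k : ℝ)) * h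

theorem rpow_posMass_le {α s : ℝ} (h0 : 0 < α) (h1 : α < 1) (hs : 0 ≤ s)
    (h : α * s = (1 - α) * Real.log 2) (n : ℕ) (z : ℤ) :
    (posMass n z * Real.exp (s * z)) ^ α ≤ ∑ f ∈ configs n, mass n f z ^ α := by
  rcases (posMass_nonneg n z).eq_or_lt with hP | hP
  · rw [← hP, zero_mul, Real.zero_rpow h0.ne']
    exact Finset.sum_nonneg fun f _ => Real.rpow_nonneg (mass_nonneg _ _ _) _
  · set c : ℝ := 2⁻¹ ^ (z.natAbs + 1) * posMass n z with hc
    have hc0 : 0 < c := by positivity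
    -- Here $x^{\alpha-1}$ is decreasing, so the upper bound `c` on the mass bounds its $\alpha$-th
    -- power from below, linearly in the mass.
    have key : ∀ f, mass n f z * c ^ (α - 1) ≤ mass n f z ^ α := by
      intro f
      rcases (mass_nonneg n f z).eq_or_lt with hm | hm
      · rw [← hm, zero_mul, Real.zero_rpow h0.ne']
      · calc mass n f z * c ^ (α - 1) ≤ mass n f z * mass n f z ^ (α - 1) :=
              mul_le_mul_of_nonneg_left
                (Real.rpow_le_rpow_of_nonpos hm (mass_le n f z) (by linarith)) hm.le
          _ = mass n f z ^ α := by
              rw [← Real.rpow_one_add' hm.le (by linarith)]; congr 1; ring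
    refine le_trans ?_ (Finset.sum_le_sum fun f _ => key f)
    rw [← Finset.sum_mul, sum_configs_mass, hc, Real.mul_rpow (by positivity) hP.le,
      inv_two_pow_rpow h, Real.mul_rpow hP.le (Real.exp_nonneg _), ← Real.exp_mul,
      mul_left_comm, ← Real.rpow_one_add' hP.le (by linarith), add_sub_cancel, mul_comm]
    refine mul_le_mul_of_nonneg_right (Real.exp_le_exp.2 ?_) (by positivity)
    have : (z : ℝ) ≤ ((z.natAbs + 1 : ℕ) : ℝ) := by
      rw [← Int.cast_natCast, Int.cast_le]
      omega
    rw [mul_comm (s * z)]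
    gcongr

theorem cosh_pow_rpow_le {α s : ℝ} (h0 : 0 < α) (h1 : α < 1) (hs : 0 ≤ s)
    (h : α * s = (1 - α) * Real.log 2) (n : ℕ) :
    (Real.cosh s ^ n) ^ α ≤ ∑ p ∈ states n, mass n p.1 p.2 ^ α := by
  rw [states, Finset.sum_product_right, ← sum_posMass_mul_exp]
  exact (Real.rpow_sum_le_sum_rpow _
    (fun z => mul_nonneg (posMass_nonneg n z) (Real.exp_nonneg _)) h0 h1.le).trans
    (Finset.sum_le_sum fun z _ => rpow_posMass_le h0 h1 hs h n z)

/-! ### Upper bound for α < 1. -/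

/-- The sum over the subintervals of `[-n, n]` of the uniform masses of a configuration. -/
noncomputable def intervalMass (n : ℕ) (f : ℤ →₀ ZMod 2) : ℝ :=
  ∑ q ∈ Finset.Icc (-n : ℤ) n ×ˢ Finset.Icc (-n : ℤ) n, uniformMass (Finset.Icc q.1 q.2) f

theorem sum_intervalMass (n : ℕ) :
    ∑ p ∈ states n, intervalMass n p.1 = (2 * n + 1) ^ 3 := by
  have hcard : (((Finset.Icc (-n : ℤ) n).card : ℕ) : ℝ) = 2 * n + 1 := by
    rw [Int.card_Icc, show (n + 1 - -n : ℤ).toNat = 2 * n + 1 by omega]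
    push_cast; ring
  have h : ∑ f ∈ configs n, intervalMass n f = (2 * n + 1) ^ 2 := by
    simp only [intervalMass]
    rw [Finset.sum_comm, Finset.sum_congr rfl fun q hq => sum_uniformMass (n := n) ?_]
    · rw [Finset.sum_const, Finset.card_product, nsmul_eq_mul, Nat.cast_mul, hcard]
      ring
    · rw [Finset.mem_product, Finset.mem_Icc, Finset.mem_Icc] at hq
      exact Finset.Icc_subset_Icc hq.1.1 hq.2.2
  rw [states, Finset.sum_product_right]
  simp only [h, Finset.sum_const, nsmul_eq_mul, hcard]
  ring

theorem uniformMass_le_intervalMass {n : ℕ} {a b : ℤ} (ha : a ∈ Finset.Icc (-n : ℤ) n)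
    (hb : b ∈ Finset.Icc (-n : ℤ) n) (f : ℤ →₀ ZMod 2) :
    uniformMass (Finset.Icc a b) f ≤ intervalMass n f := by
  have h : (a, b) ∈ Finset.Icc (-n : ℤ) n ×ˢ Finset.Icc (-n : ℤ) n :=
    Finset.mem_product.2 ⟨ha, hb⟩
  rw [intervalMass, ← Finset.add_sum_erase _ _ h]
  exact le_add_of_nonneg_right (Finset.sum_nonneg fun q _ => uniformMass_nonneg _ _)

theorem intervalMass_pos {n : ℕ} {f : ℤ →₀ ZMod 2} (hf : f ∈ configs n) :
    0 < intervalMass n f := by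
  refine lt_of_lt_of_le ?_ (uniformMass_le_intervalMass (a := -n) (b := n) ?_ ?_ f)
  · rw [uniformMass, if_pos (mem_configs.1 hf)]; positivity
  all_goals rw [Finset.mem_Icc]; omega

theorem sum_states_pathMass {n : ℕ} (ω : Fin n → Bool) :
    ∑ p ∈ states n, pathMass ω p.1 p.2 = 1 := by
  rw [states, Finset.sum_product]
  simp only [pathMass]
  simp only [Finset.sum_ite_eq, if_pos (pathPos_mem_Icc ω)]
  exact sum_uniformMass (pathRange_subset ω)

/-- The range is one of the intervals summed in the weight, so the weight is at least $2^{-|R|}$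
where the path mass is nonzero; the exponent is negative, and the choice of $s$ turns this power
into $e^{s|R|}$. -/
theorem pathMass_mul_intervalMass_rpow_le {α s : ℝ} (h0 : 0 < α) (h1 : α < 1)
    (h : α * s = (1 - α) * Real.log 2) {n : ℕ} (ω : Fin n → Bool) (f : ℤ →₀ ZMod 2) (z : ℤ) :
    pathMass ω f z * intervalMass n f ^ ((α - 1) / α) ≤
      pathMass ω f z * Real.exp (s * (pathRange ω).card) := by
  by_cases hf : f.support ⊆ pathRange ω
  · refine mul_le_mul_of_nonneg_left ?_ (pathMass_nonneg _ _ _)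
    obtain ⟨a, b, ha, ha', hb', hb, -, -, hab⟩ := pathRange_eq_Icc ω
    have hle := uniformMass_le_intervalMass (n := n) (a := a) (b := b)
      (Finset.mem_Icc.2 ⟨ha, by omega⟩) (Finset.mem_Icc.2 ⟨by omega, hb⟩) f
    rw [← hab, uniformMass, if_pos hf] at hle
    refine (Real.rpow_le_rpow_of_nonpos (by positivity) hle
      (div_nonpos_of_nonpos_of_nonneg (by linarith) h0.le)).trans (le_of_eq ?_)
    rw [div_eq_mul_inv, Real.rpow_mul (by positivity), inv_two_pow_rpow h, ← Real.exp_mul]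
    congr 1
    field_simp
  · simp [pathMass, uniformMass, hf]

theorem sum_mass_mul_intervalMass_rpow_le {α s : ℝ} (h0 : 0 < α) (h1 : α < 1)
    (h : α * s = (1 - α) * Real.log 2) (n : ℕ) :
    ∑ p ∈ states n, mass n p.1 p.2 * intervalMass n p.1 ^ ((α - 1) / α) ≤
      Real.exp s * (n + 1) ^ 2 * Real.cosh s ^ n := by
  refine le_trans ?_ (sum_exp_card_pathRange_le n s)
  simp only [mass, mul_assoc, ← Finset.mul_sum]
  refine mul_le_mul_of_nonneg_left ?_ (by positivity)
  simp only [Finset.sum_mul]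
  rw [Finset.sum_comm]
  refine Finset.sum_le_sum fun ω _ => ?_
  refine (Finset.sum_le_sum fun p _ =>
    pathMass_mul_intervalMass_rpow_le h0 h1 h ω p.1 p.2).trans (le_of_eq ?_)
  rw [← Finset.sum_mul, sum_states_pathMass, one_mul]

/-- With $w$ the interval weight, write $m^\alpha=(m^\alpha w^{\alpha-1})\,w^{1-\alpha}$ and apply
Hölder with exponents $1/\alpha$ and $1/(1-\alpha)$. -/
theorem sum_mass_rpow_le {α s : ℝ} (h0 : 0 < α) (h1 : α < 1)
    (h : α * s = (1 - α) * Real.log 2) (n : ℕ) :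
    ∑ p ∈ states n, mass n p.1 p.2 ^ α ≤
      (Real.exp s * (n + 1) ^ 2 * Real.cosh s ^ n) ^ α * ((2 * n + 1) ^ 3) ^ (1 - α) := by
  have hq : (1 / α).HolderConjugate (1 / (1 - α)) := by
    rw [Real.holderConjugate_iff]
    refine ⟨by rw [lt_div_iff₀ h0]; linarith, by simp⟩
  have hpos : ∀ p ∈ states n, 0 < intervalMass n p.1 := fun p hp =>
    intervalMass_pos (Finset.mem_product.1 hp).1
  have hH := Real.inner_le_Lp_mul_Lq_of_nonneg (states n)
    (f := fun p => mass n p.1 p.2 ^ α * intervalMass n p.1 ^ (α - 1))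
    (g := fun p => intervalMass n p.1 ^ (1 - α)) hq
    (fun p hp => mul_nonneg (Real.rpow_nonneg (mass_nonneg _ _ _) _)
      (Real.rpow_nonneg (hpos p hp).le _))
    (fun p hp => Real.rpow_nonneg (hpos p hp).le _)
  have e1 : ∀ p ∈ states n, mass n p.1 p.2 ^ α * intervalMass n p.1 ^ (α - 1) *
      intervalMass n p.1 ^ (1 - α) = mass n p.1 p.2 ^ α := by
    intro p hp
    rw [mul_assoc, ← Real.rpow_add (hpos p hp)]
    simp
  have e2 : ∀ p ∈ states n, (mass n p.1 p.2 ^ α * intervalMass n p.1 ^ (α - 1)) ^ (1 / α) =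
      mass n p.1 p.2 * intervalMass n p.1 ^ ((α - 1) / α) := by
    intro p hp
    have hm := mass_nonneg n p.1 p.2
    have hp' := (hpos p hp).le
    rw [Real.mul_rpow (Real.rpow_nonneg hm _) (Real.rpow_nonneg hp' _), ← Real.rpow_mul hm,
      ← Real.rpow_mul hp', mul_one_div_cancel h0.ne', Real.rpow_one, mul_one_div]
  have e3 : ∀ p ∈ states n, (intervalMass n p.1 ^ (1 - α)) ^ (1 / (1 - α)) =
      intervalMass n p.1 := by
    intro p hp
    rw [← Real.rpow_mul (hpos p hp).le, mul_one_div_cancel (by linarith), Real.rpow_one]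
  rw [Finset.sum_congr rfl e1, Finset.sum_congr rfl e2, Finset.sum_congr rfl e3,
    sum_intervalMass, one_div_one_div, one_div_one_div] at hH
  refine hH.trans (mul_le_mul_of_nonneg_right (Real.rpow_le_rpow ?_ ?_ h0.le) (by positivity))
  · exact Finset.sum_nonneg fun p hp =>
      mul_nonneg (mass_nonneg _ _ _) (Real.rpow_nonneg (hpos p hp).le _)
  · exact sum_mass_mul_intervalMass_rpow_le h0 h1 h n

/-! ### Entropies as finite sums, and the limit for α < 1. -/

theorem sum_states_mass (n : ℕ) : ∑ p ∈ states n, mass n p.1 p.2 = 1 := by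
  have h := sum_posMass_mul_exp n 0
  simp only [zero_mul, Real.exp_zero, mul_one, Real.cosh_zero, one_pow] at h
  rw [states, Finset.sum_product_right]
  simpa only [sum_configs_mass] using h

theorem renyiEntropy_eq {α : ℝ} (h0 : 0 < α) (h1 : α ≠ 1) {n : ℕ} (hn : n ≠ 0) :
    renyiEntropy α (swsMeasure.groupConvPow n) =
      1 / (1 - α) * Real.log (∑ p ∈ states n, mass n p.1 p.2 ^ α) := by
  rw [renyiEntropy, if_neg h1, groupConvPow_eq_switchedLaw hn,
    tsum_switchedLaw n (φ := fun x => x ^ α) (Real.zero_rpow h0.ne')]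

theorem renyiEntropy_one_eq {n : ℕ} (hn : n ≠ 0) :
    renyiEntropy 1 (swsMeasure.groupConvPow n) =
      ∑ p ∈ states n, mass n p.1 p.2 * Real.log (1 / mass n p.1 p.2) := by
  rw [renyiEntropy, if_pos rfl, groupConvPow_eq_switchedLaw hn,
    tsum_switchedLaw n (φ := fun x => x * Real.log (1 / x)) (by simp)]

/-- The value of the asymptotic Rényi entropy of the SWS walk for `α < 1`. -/
noncomputable def renyiRate (α : ℝ) : ℝ :=
  α / (1 - α) * Real.log (Real.cosh ((1 - α) / α * Real.log 2))

theorem renyiRate_le {α : ℝ} (h0 : 0 < α) (h1 : α < 1) {n : ℕ} (hn : n ≠ 0) :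
    renyiRate α ≤ 1 / (n : ℝ) * renyiEntropy α (swsMeasure.groupConvPow n) := by
  have hn' : (0 : ℝ) < n := by positivity
  have h1' : 0 < 1 - α := by linarith
  have hlog : 0 < Real.log 2 := Real.log_pos one_lt_two
  set s := (1 - α) / α * Real.log 2 with hs
  have h := cosh_pow_rpow_le h0 h1 (s := s) (by positivity) (by rw [hs]; field_simp) n
  have h2 := Real.log_le_log (by positivity) h
  rw [Real.log_rpow (by positivity), Real.log_pow] at h2
  rw [renyiEntropy_eq h0 h1.ne hn, renyiRate]
  calc α / (1 - α) * Real.log (Real.cosh s)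
      = 1 / (n : ℝ) * (1 / (1 - α) * (α * (n * Real.log (Real.cosh s)))) := by field_simp
    _ ≤ _ := by gcongr

theorem renyiEntropy_div_le {α : ℝ} (h0 : 0 < α) (h1 : α < 1) {n : ℕ} (hn : n ≠ 0) :
    1 / (n : ℝ) * renyiEntropy α (swsMeasure.groupConvPow n) ≤ renyiRate α +
      (Real.log 2 / n + (2 * α / (1 - α) + 3) * (Real.log 3 / n + Real.log n / n)) := by
  have hn' : (0 : ℝ) < n := by positivity
  have hn1 : (1 : ℝ) ≤ n := by exact_mod_cast Nat.one_le_iff_ne_zero.2 hn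
  have h1' : 0 < 1 - α := by linarith
  have hlog : 0 < Real.log 2 := Real.log_pos one_lt_two
  set s := (1 - α) / α * Real.log 2 with hs
  have hαs : α * s = (1 - α) * Real.log 2 := by rw [hs]; field_simp
  have h := sum_mass_rpow_le h0 h1 hαs n
  have hpos : 0 < ∑ p ∈ states n, mass n p.1 p.2 ^ α :=
    lt_of_lt_of_le (by positivity) (cosh_pow_rpow_le h0 h1 (s := s) (by positivity) hαs n)
  have h2 := Real.log_le_log hpos h
  rw [Real.log_mul (by positivity) (by positivity), Real.log_rpow (by positivity),
    Real.log_rpow (by positivity), Real.log_mul (by positivity) (by positivity),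
    Real.log_mul (by positivity) (by positivity), Real.log_exp, Real.log_pow, Real.log_pow,
    Real.log_pow] at h2
  -- For $n\ge1$ both polynomial bases $2n+1$ and $n+1$ are at most $3n$.
  have h3 : Real.log (2 * n + 1) ≤ Real.log 3 + Real.log n := by
    rw [← Real.log_mul (by norm_num) hn'.ne']
    exact Real.log_le_log (by positivity) (by linarith)
  have h4 : Real.log (n + 1) ≤ Real.log 3 + Real.log n := by
    rw [← Real.log_mul (by norm_num) hn'.ne']
    exact Real.log_le_log (by positivity) (by linarith)
  have h5 : Real.log (∑ p ∈ states n, mass n p.1 p.2 ^ α) ≤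
      α * (n * Real.log (Real.cosh s)) + (1 - α) * Real.log 2 +
        (2 * α + 3 * (1 - α)) * (Real.log 3 + Real.log n) := by
    have h6 := mul_le_mul_of_nonneg_left h4 h0.le
    have h7 := mul_le_mul_of_nonneg_left h3 h1'.le
    push_cast at h2
    linarith
  rw [renyiEntropy_eq h0 h1.ne hn, renyiRate, ← hs]
  calc 1 / (n : ℝ) * (1 / (1 - α) * Real.log (∑ p ∈ states n, mass n p.1 p.2 ^ α))
      ≤ 1 / (n : ℝ) * (1 / (1 - α) * (α * (n * Real.log (Real.cosh s)) + (1 - α) * Real.log 2 +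
        (2 * α + 3 * (1 - α)) * (Real.log 3 + Real.log n))) := by gcongr
    _ = _ := by
        field_simp
        ring

theorem tendsto_renyiEntropy_of_lt_one {α : ℝ} (h0 : 0 < α) (h1 : α < 1) :
    Tendsto (fun n : ℕ => 1 / (n : ℝ) * renyiEntropy α (swsMeasure.groupConvPow n)) atTop
      (𝓝 (renyiRate α)) := by
  have hlog : Tendsto (fun n : ℕ => Real.log n / n) atTop (𝓝 0) :=
    (Real.isLittleO_log_id_atTop.tendsto_div_nhds_zero).comp tendsto_natCast_atTop_atTop
  have hc : ∀ c : ℝ, Tendsto (fun n : ℕ => c / (n : ℝ)) atTop (𝓝 0) :=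
    tendsto_const_div_atTop_nhds_zero_nat
  have hup : Tendsto (fun n : ℕ => renyiRate α + (Real.log 2 / n +
      (2 * α / (1 - α) + 3) * (Real.log 3 / n + Real.log n / n))) atTop (𝓝 (renyiRate α)) := by
    simpa using ((hc (Real.log 2)).add (((hc (Real.log 3)).add hlog).const_mul
      (2 * α / (1 - α) + 3))).const_add (renyiRate α)
  refine tendsto_of_tendsto_of_tendsto_of_le_of_le' tendsto_const_nhds hup ?_ ?_
  · filter_upwards [eventually_ne_atTop 0] with n hn using renyiRate_le h0 h1 hn
  · filter_upwards [eventually_ne_atTop 0] with n hn using renyiEntropy_div_le h0 h1 hn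

/-! ### Monotonicity in the order, and the limit for α ≥ 1. -/

theorem mass_le_one {n : ℕ} {p : (ℤ →₀ ZMod 2) × ℤ} (hp : p ∈ states n) :
    mass n p.1 p.2 ≤ 1 := by
  rw [← sum_states_mass n]
  exact Finset.single_le_sum (f := fun p : (ℤ →₀ ZMod 2) × ℤ => mass n p.1 p.2)
    (fun q _ => mass_nonneg _ _ _) hp

/-- Jensen for the logarithm, with the masses as weights and their $t$-th powers as points. The sign
of $t$ decides on which side of $H_1$ the entropy of order $1+t$ lies. -/
theorem mul_sum_mass_log_le (n : ℕ) (t : ℝ) (ht : 1 + t ≠ 0) :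
    t * ∑ p ∈ states n, mass n p.1 p.2 * Real.log (mass n p.1 p.2) ≤
      Real.log (∑ p ∈ states n, mass n p.1 p.2 ^ (1 + t)) := by
  -- Jensen needs points in $(0,\infty)$, so null states are dropped; they contribute nothing, as
  -- $0^{1+t}=0$ for $1+t\ne0$.
  set T := (states n).filter fun p => mass n p.1 p.2 ≠ 0 with hT
  have hpos : ∀ p ∈ T, 0 < mass n p.1 p.2 := fun p hp =>
    lt_of_le_of_ne (mass_nonneg _ _ _) (Finset.mem_filter.1 hp).2.symm
  have hsum : ∀ φ : ℝ → ℝ, φ 0 = 0 →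
      ∑ p ∈ T, φ (mass n p.1 p.2) = ∑ p ∈ states n, φ (mass n p.1 p.2) := by
    intro φ hφ
    refine Finset.sum_subset (Finset.filter_subset _ _) fun p hp hp' => ?_
    have : mass n p.1 p.2 = 0 := by
      by_contra h
      exact hp' (Finset.mem_filter.2 ⟨hp, h⟩)
    rw [this, hφ]
  rw [← hsum (fun x => x * Real.log x) (by simp),
    ← hsum (fun x => x ^ (1 + t)) (Real.zero_rpow ht)]
  have hJ := strictConcaveOn_log_Ioi.concaveOn.le_map_sum (t := T)
    (w := fun p => mass n p.1 p.2) (p := fun p => mass n p.1 p.2 ^ t)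
    (fun p hp => (hpos p hp).le) ((hsum id rfl).trans (sum_states_mass n))
    (fun p hp => Real.rpow_pos_of_pos (hpos p hp) t)
  simp only [smul_eq_mul] at hJ
  rw [Finset.mul_sum]
  refine le_trans (le_of_eq ?_) (hJ.trans (le_of_eq ?_))
  · refine Finset.sum_congr rfl fun p hp => ?_
    rw [Real.log_rpow (hpos p hp)]
    ring
  · congr 1
    refine Finset.sum_congr rfl fun p hp => ?_
    rw [Real.rpow_add (hpos p hp), Real.rpow_one]

theorem renyiEntropy_one_eq_neg {n : ℕ} (hn : n ≠ 0) :
    renyiEntropy 1 (swsMeasure.groupConvPow n) =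
      -∑ p ∈ states n, mass n p.1 p.2 * Real.log (mass n p.1 p.2) := by
  rw [renyiEntropy_one_eq hn, ← Finset.sum_neg_distrib]
  refine Finset.sum_congr rfl fun p _ => ?_
  rw [one_div, Real.log_inv, mul_neg]

theorem renyiEntropy_one_le {β : ℝ} (h0 : 0 < β) (h1 : β < 1) {n : ℕ} (hn : n ≠ 0) :
    renyiEntropy 1 (swsMeasure.groupConvPow n) ≤ renyiEntropy β (swsMeasure.groupConvPow n) := by
  have h1' : 0 < 1 - β := by linarith
  have h := mul_sum_mass_log_le n (β - 1) (by simpa using h0.ne')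
  rw [add_sub_cancel] at h
  rw [renyiEntropy_one_eq_neg hn, renyiEntropy_eq h0 h1.ne hn, one_div, ← div_eq_inv_mul,
    le_div_iff₀ h1']
  linarith

theorem renyiEntropy_le_one {α : ℝ} (h1 : 1 < α) {n : ℕ} (hn : n ≠ 0) :
    renyiEntropy α (swsMeasure.groupConvPow n) ≤ renyiEntropy 1 (swsMeasure.groupConvPow n) := by
  have h1' : 0 < α - 1 := by linarith
  have h := mul_sum_mass_log_le n (α - 1) (by rw [add_sub_cancel]; linarith)
  rw [add_sub_cancel] at h
  rw [renyiEntropy_one_eq_neg hn, renyiEntropy_eq (by linarith) h1.ne' hn,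
    show 1 - α = -(α - 1) by ring, one_div, inv_neg, neg_mul, neg_le_neg_iff, ← div_eq_inv_mul,
    le_div_iff₀ h1']
  linarith

theorem renyiEntropy_nonneg {α : ℝ} (h1 : 1 ≤ α) {n : ℕ} (hn : n ≠ 0) :
    0 ≤ renyiEntropy α (swsMeasure.groupConvPow n) := by
  rcases h1.eq_or_lt with rfl | h1
  · rw [renyiEntropy_one_eq_neg hn, neg_nonneg]
    exact Finset.sum_nonpos fun p hp => mul_nonpos_of_nonneg_of_nonpos (mass_nonneg _ _ _)
      (Real.log_nonpos (mass_nonneg _ _ _) (mass_le_one hp))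
  · rw [renyiEntropy_eq (by linarith) h1.ne' hn]
    refine mul_nonneg_of_nonpos_of_nonpos
      (div_nonpos_of_nonneg_of_nonpos zero_le_one (by linarith)) (Real.log_nonpos ?_ ?_)
    · exact Finset.sum_nonneg fun p _ => Real.rpow_nonneg (mass_nonneg _ _ _) _
    · rw [← sum_states_mass n]
      refine Finset.sum_le_sum fun p hp => ?_
      simpa using Real.rpow_le_rpow_of_exponent_ge' (mass_nonneg n p.1 p.2) (mass_le_one hp)
        zero_le_one h1.le

theorem renyiRate_le_linear {β : ℝ} (h0 : 0 < β) (h1 : β < 1) :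
    renyiRate β ≤ (1 - β) / (2 * β) * Real.log 2 ^ 2 := by
  have h1' : 0 < 1 - β := by linarith
  have h : Real.log (Real.cosh ((1 - β) / β * Real.log 2)) ≤
      ((1 - β) / β * Real.log 2) ^ 2 / 2 := by
    rw [Real.log_le_iff_le_exp (Real.cosh_pos _)]
    exact Real.cosh_le_exp_half_sq _
  calc renyiRate β ≤ β / (1 - β) * (((1 - β) / β * Real.log 2) ^ 2 / 2) :=
        mul_le_mul_of_nonneg_left h (by positivity)
    _ = _ := by field_simp

theorem tendsto_renyiEntropy_of_one_le {α : ℝ} (h1 : 1 ≤ α) :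
    Tendsto (fun n : ℕ => 1 / (n : ℝ) * renyiEntropy α (swsMeasure.groupConvPow n)) atTop
      (𝓝 0) := by
  have hlim : Tendsto (fun β : ℝ => (1 - β) / (2 * β) * Real.log 2 ^ 2) (𝓝[<] 1) (𝓝 0) := by
    have : ContinuousAt (fun β : ℝ => (1 - β) / (2 * β) * Real.log 2 ^ 2) 1 := by
      fun_prop (disch := norm_num)
    simpa [ContinuousAt] using this.tendsto.mono_left nhdsWithin_le_nhds
  refine tendsto_order.2 ⟨fun a ha => ?_, fun ε hε => ?_⟩
  · filter_upwards [eventually_ne_atTop 0] with n hn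
    exact ha.trans_le (mul_nonneg (by positivity) (renyiEntropy_nonneg h1 hn))
  -- A fixed $\beta<1$ whose linear rate bound is already below ε.
  · obtain ⟨β, hβ, h0, hβ1⟩ := ((hlim.eventually (gt_mem_nhds hε)).and
      (Ioo_mem_nhdsLT (zero_lt_one (α := ℝ)))).exists
    have hrate := (renyiRate_le_linear h0 hβ1).trans_lt hβ
    filter_upwards [eventually_ne_atTop 0,
      (tendsto_renyiEntropy_of_lt_one h0 hβ1).eventually (gt_mem_nhds hrate)] with n hn hlt
    refine lt_of_le_of_lt (mul_le_mul_of_nonneg_left ?_ (by positivity)) hlt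
    refine le_trans ?_ (renyiEntropy_one_le h0 hβ1 hn)
    rcases h1.eq_or_lt with rfl | h1
    exacts [le_rfl, renyiEntropy_le_one h1 hn]

/-! ### Analyticity and the closed form. -/

theorem asymptoticRenyiEntropy_of_lt_one {α : ℝ} (h0 : 0 < α) (h1 : α < 1) :
    asymptoticRenyiEntropy swsMeasure α = renyiRate α :=
  (tendsto_renyiEntropy_of_lt_one h0 h1).limUnder_eq

theorem asymptoticRenyiEntropy_of_one_le {α : ℝ} (h1 : 1 ≤ α) :
    asymptoticRenyiEntropy swsMeasure α = 0 :=
  (tendsto_renyiEntropy_of_one_le h1).limUnder_eq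

theorem renyiRate_pos {α : ℝ} (h0 : 0 < α) (h1 : α < 1) : 0 < renyiRate α := by
  have h1' : 0 < 1 - α := by linarith
  have hlog : 0 < Real.log 2 := Real.log_pos one_lt_two
  exact mul_pos (by positivity)
    (Real.log_pos (Real.one_lt_cosh.2 (mul_pos (by positivity) hlog).ne'))

theorem analyticAt_renyiRate {α : ℝ} (h0 : 0 < α) (h1 : α < 1) : AnalyticAt ℝ renyiRate α := by
  have h1' : 1 - α ≠ 0 := by linarith
  unfold renyiRate
  refine (analyticAt_id.div (analyticAt_const.sub analyticAt_id) h1').mul (AnalyticAt.log ?_ ?_)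
  · refine (Real.analyticAt_cosh).comp_of_eq (x := α) ?_ rfl
    exact ((analyticAt_const.sub analyticAt_id).div analyticAt_id h0.ne').mul analyticAt_const
  · exact Real.cosh_pos _

theorem swsPhi_eq_renyiRate {α : ℝ} (h0 : 0 < α) (h1 : α < 1) :
    swsPhi α (((4 : ℝ) ^ (1 / α) - 4) / ((4 : ℝ) ^ (1 / α) + 4)) = renyiRate α := by
  have h1' : 1 - α ≠ 0 := by linarith
  set s := (1 - α) / α * Real.log 2 with hs
  set e := Real.exp s with he
  have hepos : 0 < e := Real.exp_pos s
  have h4 : (4 : ℝ) ^ (1 / α) = 4 * e ^ 2 := by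
    have h5 : Real.log 4 = 2 * Real.log 2 := by
      rw [show (4 : ℝ) = 2 ^ 2 by norm_num, Real.log_pow, Nat.cast_ofNat]
    rw [← Real.exp_log (show (0 : ℝ) < 4 * e ^ 2 by positivity),
      Real.log_mul (by norm_num) (by positivity), Real.log_pow, he, Real.log_exp,
      Real.rpow_def_of_pos (by norm_num), h5, hs]
    congr 1
    push_cast
    field_simp
    ring
  set q := e ^ 2 + 1 with hq
  have hqpos : 0 < q := by positivity
  -- With $e=\exp s$ this is $\tanh s$.
  have hp : ((4 : ℝ) ^ (1 / α) - 4) / ((4 : ℝ) ^ (1 / α) + 4) = (e ^ 2 - 1) / q := by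
    rw [h4, hq]; field_simp
  have hm : 1 - (e ^ 2 - 1) / q = 2 / q := by field_simp; rw [hq]; ring
  have hpl : 1 + (e ^ 2 - 1) / q = 2 * e ^ 2 / q := by field_simp; rw [hq]; ring
  have hloge : Real.log e = s := Real.log_exp s
  have hcosh : Real.log (Real.cosh s) = Real.log q - Real.log 2 - s := by
    have : Real.cosh s = q / (2 * e) := by
      rw [Real.cosh_eq, Real.exp_neg, ← he, hq]; field_simp
    rw [this, Real.log_div hqpos.ne' (by positivity), Real.log_mul two_ne_zero hepos.ne', hloge]
    ring
  have hlog2 : Real.log 2 = α / (1 - α) * s := by rw [hs]; field_simp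
  rw [hp, swsPhi, hm, hpl, renyiRate, ← hs, hcosh, Real.log_div two_ne_zero hqpos.ne',
    Real.log_div (by positivity) hqpos.ne', Real.log_mul two_ne_zero (by positivity),
    Real.log_pow, hloge]
  have hA : α / (2 * (1 - α)) = α / (1 - α) / 2 := by field_simp
  rw [hA]
  have hx : (e ^ 2 - 1) / q = 2 * e ^ 2 / q - 1 := by linarith
  have hy : 2 / q = 2 - 2 * e ^ 2 / q := by linarith
  rw [hx, hy]
  push_cast
  linear_combination (2 * e ^ 2 / q - 1) * hlog2

theorem not_analyticAt_asymptoticRenyiEntropy :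
    ¬ AnalyticAt ℝ (asymptoticRenyiEntropy swsMeasure) 1 := by
  intro h
  -- Isolated zeros: the first case contradicts positivity on the left of 1, the second vanishing on
  -- the right.
  rcases h.eventually_eq_zero_or_eventually_ne_zero with h | h
  · obtain ⟨α, hα, h0, h1⟩ := ((h.filter_mono nhdsWithin_le_nhds).and
      (Ioo_mem_nhdsLT (zero_lt_one (α := ℝ)))).exists
    rw [asymptoticRenyiEntropy_of_lt_one h0 h1] at hα
    exact (renyiRate_pos h0 h1).ne' hα
  · have hle : 𝓝[>] (1 : ℝ) ≤ 𝓝[≠] 1 := nhdsWithin_mono _ fun x hx => (Set.mem_Ioi.1 hx).ne'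
    obtain ⟨α, hα, h1⟩ := ((h.filter_mono hle).and self_mem_nhdsWithin).exists
    exact hα (asymptoticRenyiEntropy_of_one_le (Set.mem_Ioi.1 h1).le)

theorem analyticAt_asymptoticRenyiEntropy {α : ℝ} (h0 : 0 < α) (h1 : α ≠ 1) :
    AnalyticAt ℝ (asymptoticRenyiEntropy swsMeasure) α := by
  rcases lt_or_gt_of_ne h1 with h1 | h1
  · refine (analyticAt_renyiRate h0 h1).congr ?_
    filter_upwards [Ioo_mem_nhds h0 h1] with β hβ
    exact (asymptoticRenyiEntropy_of_lt_one hβ.1 hβ.2).symm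
  · refine (analyticAt_const (v := (0 : ℝ))).congr ?_
    filter_upwards [Ioi_mem_nhds h1] with β hβ
    exact (asymptoticRenyiEntropy_of_one_le (Set.mem_Ioi.1 hβ).le).symm

end Lamplighter

theorem mainTheorem5 :
    (∀ α : ℝ, 0 < α →
      Tendsto (fun n : ℕ => 1 / (n : ℝ) * renyiEntropy α (Lamplighter.swsMeasure.groupConvPow n))
        atTop (𝓝 (asymptoticRenyiEntropy Lamplighter.swsMeasure α))) ∧
    AnalyticOnNhd ℝ (asymptoticRenyiEntropy Lamplighter.swsMeasure) (Set.Ioi 0 \ {1}) ∧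
    ¬ AnalyticAt ℝ (asymptoticRenyiEntropy Lamplighter.swsMeasure) 1 ∧
    (∀ α : ℝ, 0 < α → α < 1 →
      asymptoticRenyiEntropy Lamplighter.swsMeasure α =
        swsPhi α (((4 : ℝ) ^ (1 / α) - 4) / ((4 : ℝ) ^ (1 / α) + 4))) ∧
    (∀ α : ℝ, 1 ≤ α → asymptoticRenyiEntropy Lamplighter.swsMeasure α = 0) := by
  refine ⟨fun α h0 => ?_, fun α hα => ?_, Lamplighter.not_analyticAt_asymptoticRenyiEntropy,
    fun α h0 h1 => ?_, fun α h1 => Lamplighter.asymptoticRenyiEntropy_of_one_le h1⟩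
  · rcases lt_or_ge α 1 with h1 | h1
    · rw [Lamplighter.asymptoticRenyiEntropy_of_lt_one h0 h1]
      exact Lamplighter.tendsto_renyiEntropy_of_lt_one h0 h1
    · rw [Lamplighter.asymptoticRenyiEntropy_of_one_le h1]
      exact Lamplighter.tendsto_renyiEntropy_of_one_le h1
  · exact Lamplighter.analyticAt_asymptoticRenyiEntropy hα.1 hα.2
  · rw [Lamplighter.asymptoticRenyiEntropy_of_lt_one h0 h1,
      Lamplighter.swsPhi_eq_renyiRate h0 h1]
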